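/- **Setting.** Let $f:\mathbb R^{n_x}\times\mathbb R^{n_u}\to\mathbb R^{n_x}$, $h_x:\mathbb R^{n_x}\to\mathbb R$, $h_u:\mathbb R^{n_u}\to\mathbb R$, $\mathcal X=\{x\mid h_x(x)\le 0\}$, $\mathcal U=\{u\mid h_u(u)\le 0\}$. *(A1) System.* $f$ is locally Lipschitz, $h_x,h_u$ are continuous, and there are a set $\mathcal R\subseteq\mathbb R^{n_r}$ and continuous functions $r\mapsto\bar x_r\in\mathcal X$, $r\mapsto\bar u_r\in\mathcal U$ on $\mathcal R$ with $f(\bar x_r,\bar u_r)=\bar x_r$ for all $r\in\mathcal R$. For a fixed $\epsilon>0$ put $\mathcal R_\epsilon=\{r\in\mathcal R\mid h_x(\bar x_r)\le-\epsilon,\ h_u(\bar u_r)\le-\epsilon\}$. *Optimal control problem.* Let $N\ge 1$, $\mathcal T\subseteq\mathcal X\times\mathcal R$, $\ell:\mathcal X\times\mathcal U\times\mathcal R_\epsilon\to\mathbb R_{\ge0}$, $V:\mathcal T\to\mathbb R_{\ge 0}$. For $(x,r)\in\mathcal X\times\mathcal R_\epsilon$ minimize $V(\xi_N,r)+\sum_{i=0}^{N-1}\ell(\xi_i,\mu_i,r)$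 over $\xi=(\xi_0,\dots,\xi_N)$ and $\mu=(\mu_0,\dots,\mu_{N-1})$ subject to $\xi_0=x$; $\xi_{i+1}=f(\xi_i,\mu_i)$, $\xi_i\in\mathcal X$, $\mu_i\in\mathcal U$ for $0\le i\le N-1$; and $(\xi_N,r)\in\mathcal T$. Let $\Gamma$ be the set of $(x,r)\in\mathcal X\times\mathcal R_\epsilon$ for which some $(\xi,\mu)$ satisfies these constraints. A minimizer exists for every $(x,r)\in\Gamma$; let $\zeta^*(x,r)=(\xi^*(x,r),\mu^*(x,r))$ be the minimizer (a selected one, if it is not unique), and $\kappa(x,r)=\mu_0^*(x,r)$. *(A2) Controller.* (i) $\ell$ is uniformly continuous, $\ell(\bar x_r,\bar u_r,r)=0$ for $r\in\mathcal R_\epsilon$, and there is $\gamma\in\mathcal K_\infty$ with $\ell(x,u,r)\ge\gamma(\|x-\bar x_r\|)$ for all $(x,r)\in\Gamma$, $u\in\mathcal U$. (ii) $V$ is uniformly continuous, $V(\bar x_r,r)=0$ for $r\in\mathcal R_\epsilon$, and there is $\kappa_T:\mathcal T\to\mathcal U$ such that, with $x^+=f(x,\kappa_T(x,r))$, $V(x^+,r)-V(x,r)\le-\ell(x,\kappa_T(x,r),r)$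 for all $(x,r)\in\mathcal T$ with $r\in\mathcal R_\epsilon$. (iii) For the same $\kappa_T$, $(x,r)\in\mathcal T$ implies $(x^+,r)\in\mathcal T$, $x\in\mathcal X$ and $\kappa_T(x,r)\in\mathcal U$. (iv) $(\bar x_r,r)\in\operatorname{Int}\mathcal T$ for all $r\in\mathcal R_\epsilon$. (v) $\zeta^*$ is Lipschitz continuous on $\Gamma$. *(A3) Planner.* A feasible path from $x_0$ to $r$ is a continuous $p:[0,1]\to\mathcal R_\epsilon$ with $(x_0,p(0))\in\Gamma$ and $p(1)=r$. Let $\mathcal D$ be the set of $(x_0,r)$ with $r\in\mathcal R_\epsilon$ for which such a path exists, and $\mathcal D_x(r)=\{x_0\mid(x_0,r)\in\mathcal D\}$. For each $(x_0,r)\in\mathcal D$ the planner returns a feasible path from $x_0$ to $r$. *Closed loop.* For the path $p$ in use, put $\tilde\Gamma=\{(x,s)\mid(x,p(s))\in\Gamma\}$. For $s\in[0,1]$ and $(x,s)\in\tilde\Gamma$ the closed loop is $$s^+=\max\{s'\in[0,1]\mid(\xi_N^*(x,p(s)),p(s'))\in\mathcal T\},\qquad x^+=f(x,\kappa(x,p(s))),$$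 where the maximum is assumed to be attained (for instance, because $\mathcal T$ is closed). **Theorem (Asymptotic Stability).** Assume (A1)–(A3). Let $r\in\mathcal R_\epsilon$, let $\hat x\in\mathcal D_x(r)$, and let $p$ be the path returned by the planner for $(\hat x,r)$. Then $(\bar x_r,1)$ is an asymptotically stable equilibrium of the closed loop, with region of attraction $$A=(\mathcal D_x(r)\times[0,1])\cap\tilde\Gamma .$$ That is: $(\bar x_r,1)$ is an equilibrium; $A$ is a neighbourhood of it in $\mathbb R^{n_x}\times[0,1]$; the initial states from which the closed-loop trajectory is defined for all times and converges to $(\bar x_r,1)$ are exactly the elements of $A$; and there is $\varsigma\in\mathcal K$ such that every trajectory with $(x_0,s_0)\in A$ satisfies $\|(x_k-\bar x_r,\,s_k-1)\|\le\varsigma(\|(x_0-\bar x_r,\,s_0-1)\|)$ for all $k\in\mathbb N$. -/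

import Mathlib

open Set Filter Topology

/-- The Euclidean space of `n`-dimensional real vectors. -/
abbrev Vec (n : ℕ) : Type := EuclideanSpace ℝ (Fin n)

/-! ### Comparison functions -/

/-- Class `K`: continuous, strictly increasing on `[0, ∞)`, zero at zero. -/
structure IsClassK (γ : ℝ → ℝ) : Prop where
  continuousOn : ContinuousOn γ (Ici 0)
  strictMonoOn : StrictMonoOn γ (Ici 0)
  zero : γ 0 = 0

/-- Class `K_∞`: class `K` and unbounded. -/
structure IsClassKInfty (γ : ℝ → ℝ) : Prop extends IsClassK γ where
  tendsto_atTop : Tendsto γ atTop atTop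

/-! ### Asymptotic stability of a (partially defined) discrete-time system

A system on a metric space `Z` is given by its one-step relation: `step z z'` says that the
update is defined at `z` and that `z'` is the next state. -/

section Stability

variable {Z : Type*} [PseudoMetricSpace Z]

/-- `z` is a (complete forward) solution trajectory of the system. -/
def IsSolution (step : Z → Z → Prop) (z : ℕ → Z) : Prop :=
  ∀ k, step (z k) (z (k + 1))

/-- `zs` is an equilibrium: the update is defined at `zs` and returns `zs` and nothing else. -/
def IsEquilibrium (step : Z → Z → Prop) (zs : Z) : Prop :=
  step zs zs ∧ ∀ z', step zs z' → z' = zs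

/-- The region of attraction of `zs`: all initial states from which a solution trajectory exists
for all time, and from which every solution trajectory converges to `zs`. -/
def regionOfAttraction (step : Z → Z → Prop) (zs : Z) : Set Z :=
  {z₀ | (∃ z, IsSolution step z ∧ z 0 = z₀) ∧
    ∀ z, IsSolution step z → z 0 = z₀ → Tendsto z atTop (𝓝 zs)}

/-- Lyapunov stability of `zs` on the set `A` of initial states, through a class-`K` bound. -/
def IsLyapunovStableOn (step : Z → Z → Prop) (zs : Z) (A : Set Z) : Prop :=
  ∃ ς : ℝ → ℝ, IsClassK ς ∧
    ∀ z, IsSolution step z → z 0 ∈ A → ∀ k, dist (z k) zs ≤ ς (dist (z 0) zs)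

/-- `zs` is an asymptotically stable equilibrium of the system with state space `S`, and `A` is
its region of attraction: `zs` is an equilibrium, `A` is exactly the region of attraction, it is a
neighbourhood of `zs` in `S`, and `zs` is Lyapunov stable on all of `A`. -/
structure IsAsymptoticallyStableWithROA (step : Z → Z → Prop) (S : Set Z) (zs : Z) (A : Set Z) :
    Prop where
  equilibrium : IsEquilibrium step zs
  stable : IsLyapunovStableOn step zs A
  roa_eq : regionOfAttraction step zs = A
  roa_nhds : A ∈ 𝓝[S] zs

end Stability

/-! ### The constrained tracking problem and the optimal control problem -/

/-- The data of the tracking problem and of the optimal control problem with horizon `N`.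
Functions that are only meaningful on a subset are total here; every assumption on them is
restricted to the subset. -/
structure MPCData (nx nu nr N : ℕ) where
  /-- the dynamics `x⁺ = f (x, u)` -/
  f : Vec nx × Vec nu → Vec nx
  /-- the state constraint function -/
  hx : Vec nx → ℝ
  /-- the control constraint function -/
  hu : Vec nu → ℝ
  /-- the steady-state admissible references -/
  R : Set (Vec nr)
  /-- the equilibrium state of a reference -/
  xbar : Vec nr → Vec nx
  /-- the equilibrium control of a reference -/
  ubar : Vec nr → Vec nu
  /-- the margin in the definition of strict admissibility -/
  eps : ℝ
  /-- the stage cost, as a function of `(x, u, r)` -/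
  stage : Vec nx × Vec nu × Vec nr → ℝ
  /-- the terminal cost, as a function of `(x, r)` -/
  term : Vec nx × Vec nr → ℝ
  /-- the terminal set, a set of pairs `(x, r)` -/
  T : Set (Vec nx × Vec nr)

namespace MPCData

variable {nx nu nr N : ℕ}

/-- The state constraint set. -/
def X (P : MPCData nx nu nr N) : Set (Vec nx) := {x | P.hx x ≤ 0}

/-- The control constraint set. -/
def U (P : MPCData nx nu nr N) : Set (Vec nu) := {u | P.hu u ≤ 0}

/-- The strictly steady-state admissible references. -/
def Reps (P : MPCData nx nu nr N) : Set (Vec nr) :=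
  {r | r ∈ P.R ∧ P.hx (P.xbar r) ≤ -P.eps ∧ P.hu (P.ubar r) ≤ -P.eps}

/-- The system admits a well-posed tracking problem. -/
structure SystemAssumption (P : MPCData nx nu nr N) : Prop where
  eps_pos : 0 < P.eps
  f_locLip : LocallyLipschitz P.f
  hx_cont : Continuous P.hx
  hu_cont : Continuous P.hu
  xbar_cont : ContinuousOn P.xbar P.R
  ubar_cont : ContinuousOn P.ubar P.R
  xbar_mem : ∀ r ∈ P.R, P.xbar r ∈ P.X
  ubar_mem : ∀ r ∈ P.R, P.ubar r ∈ P.U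
  steady : ∀ r ∈ P.R, P.f (P.xbar r, P.ubar r) = P.xbar r

/-- Predicted states `ξ₀, …, ξ_N` and control inputs `μ₀, …, μ_{N-1}`. -/
abbrev Plan (nx nu N : ℕ) : Type := (Fin (N + 1) → Vec nx) × (Fin N → Vec nu)

/-- The constraints of the optimal control problem at `(x, r)`. -/
structure IsFeasible (P : MPCData nx nu nr N) (x : Vec nx) (r : Vec nr) (ζ : Plan nx nu N) :
    Prop where
  init : ζ.1 0 = x
  dyn : ∀ i : Fin N, ζ.1 i.succ = P.f (ζ.1 i.castSucc, ζ.2 i)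
  state_mem : ∀ i : Fin N, ζ.1 i.castSucc ∈ P.X
  control_mem : ∀ i : Fin N, ζ.2 i ∈ P.U
  terminal : (ζ.1 (Fin.last N), r) ∈ P.T

/-- The cost of the optimal control problem. -/
def cost (P : MPCData nx nu nr N) (r : Vec nr) (ζ : Plan nx nu N) : ℝ :=
  P.term (ζ.1 (Fin.last N), r) + ∑ i : Fin N, P.stage (ζ.1 i.castSucc, ζ.2 i, r)

/-- `ζ` is a minimizer of the optimal control problem at `(x, r)`. -/
def IsOptimal (P : MPCData nx nu nr N) (x : Vec nx) (r : Vec nr) (ζ : Plan nx nu N) : Prop :=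
  P.IsFeasible x r ζ ∧ ∀ ζ', P.IsFeasible x r ζ' → P.cost r ζ ≤ P.cost r ζ'

/-- The feasible set `Γ` of the optimal control problem. -/
def Gam (P : MPCData nx nu nr N) : Set (Vec nx × Vec nr) :=
  {q | q.1 ∈ P.X ∧ q.2 ∈ P.Reps ∧ ∃ ζ, P.IsFeasible q.1 q.2 ζ}

/-- `ζ` is an optimal solution map: on the feasible set, `ζ (x, r)` is a minimizer. If minimizers
are not unique, this allows any selection. -/
def IsSolutionMap (P : MPCData nx nu nr N) (ζ : Vec nx × Vec nr → Plan nx nu N) : Prop :=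
  ∀ q ∈ P.Gam, P.IsOptimal q.1 q.2 (ζ q)

/-- The assumptions on the ingredients of the model predictive controller with optimal solution
map `ζ`. -/
structure MPCAssumption (P : MPCData nx nu nr N) (ζ : Vec nx × Vec nr → Plan nx nu N) :
    Prop where
  T_subset : P.T ⊆ P.X ×ˢ P.R
  stage_nonneg : ∀ x ∈ P.X, ∀ u ∈ P.U, ∀ r ∈ P.Reps, 0 ≤ P.stage (x, u, r)
  stage_unifCont : UniformContinuousOn P.stage (P.X ×ˢ P.U ×ˢ P.Reps)
  stage_equil : ∀ r ∈ P.Reps, P.stage (P.xbar r, P.ubar r, r) = 0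
  stage_lower : ∃ γ : ℝ → ℝ, IsClassKInfty γ ∧
    ∀ q ∈ P.Gam, ∀ u ∈ P.U, γ ‖q.1 - P.xbar q.2‖ ≤ P.stage (q.1, u, q.2)
  term_unifCont : UniformContinuousOn P.term P.T
  term_equil : ∀ r ∈ P.Reps, P.term (P.xbar r, r) = 0
  term_nonneg : ∀ q ∈ P.T, 0 ≤ P.term q
  /-- There is a terminal control law for which the terminal cost decreases and the terminal set
  is positively invariant and constraint admissible. The stage cost is only defined for
  references in `P.Reps`, and so the decrease is only required there. -/
  terminal_law : ∃ κT : Vec nx × Vec nr → Vec nu, ∀ x r, (x, r) ∈ P.T →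
    (r ∈ P.Reps →
      P.term (P.f (x, κT (x, r)), r) - P.term (x, r) ≤ -P.stage (x, κT (x, r), r)) ∧
    (P.f (x, κT (x, r)), r) ∈ P.T ∧ x ∈ P.X ∧ κT (x, r) ∈ P.U
  equil_interior : ∀ r ∈ P.Reps, (P.xbar r, r) ∈ interior P.T
  solution_lipschitz : ∃ L, LipschitzOnWith L ζ P.Gam

/-! ### Paths and the path planner -/

/-- `p` is a feasible path from the initial state `x₀` to the target `r`; only its values on
`[0, 1]` matter. -/
structure IsFeasiblePath (P : MPCData nx nu nr N) (x₀ : Vec nx) (r : Vec nr) (p : ℝ → Vec nr) :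
    Prop where
  cont : ContinuousOn p (Icc 0 1)
  mem : ∀ s ∈ Icc (0 : ℝ) 1, p s ∈ P.Reps
  start : (x₀, p 0) ∈ P.Gam
  target : p 1 = r

/-- The pairs `(x₀, r)` that can be connected by a feasible path. -/
def D (P : MPCData nx nu nr N) : Set (Vec nx × Vec nr) :=
  {q | q.2 ∈ P.Reps ∧ ∃ p, P.IsFeasiblePath q.1 q.2 p}

/-- The states from which there is a feasible path to the target `r`. -/
def Dx (P : MPCData nx nu nr N) (r : Vec nr) : Set (Vec nx) := {x₀ | (x₀, r) ∈ P.D}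

/-- The path planner returns a feasible path whenever there is one. -/
def PlannerAssumption (P : MPCData nx nu nr N) (planner : Vec nx × Vec nr → ℝ → Vec nr) : Prop :=
  ∀ q ∈ P.D, P.IsFeasiblePath q.1 q.2 (planner q)

/-! ### The closed loop with the Path Feasibility Governor, along a fixed path `p` -/

/-- The feasible set in terms of `(x, s)`. -/
def GamTilde (P : MPCData nx nu nr N) (p : ℝ → Vec nr) : Set (Vec nx × ℝ) :=
  {z | (z.1, p z.2) ∈ P.Gam}

/-- The terminal set in terms of `(x, s)`. -/
def TTilde (P : MPCData nx nu nr N) (p : ℝ → Vec nr) : Set (Vec nx × ℝ) :=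
  {z | (z.1, p z.2) ∈ P.T}

/-- The auxiliary references among which the governor takes the maximum, given the last predicted
state `ξN`. -/
def candidates (P : MPCData nx nu nr N) (p : ℝ → Vec nr) (ξN : Vec nx) : Set ℝ :=
  {s | s ∈ Icc (0 : ℝ) 1 ∧ (ξN, s) ∈ P.TTilde p}

/-- The optimal final predicted state in terms of `(x, s)`. -/
def finalState (ζ : Vec nx × Vec nr → Plan nx nu N) (p : ℝ → Vec nr) (z : Vec nx × ℝ) : Vec nx :=
  (ζ (z.1, p z.2)).1 (Fin.last N)

/-- The model predictive control law in terms of `(x, s)`. -/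
def controlLaw [NeZero N] (ζ : Vec nx × Vec nr → Plan nx nu N) (p : ℝ → Vec nr)
    (z : Vec nx × ℝ) : Vec nu :=
  (ζ (z.1, p z.2)).2 0

/-- One step of the closed loop from `z = (x, s)` to `z' = (x⁺, s⁺)`. It is defined only if `s` is
in `[0, 1]` and the optimal control problem is feasible at `(x, p s)`; then `s⁺` is the greatest
candidate and `x⁺ = f (x, u)` with `u` from the model predictive control law. -/
structure ClosedLoop [NeZero N] (P : MPCData nx nu nr N) (ζ : Vec nx × Vec nr → Plan nx nu N)
    (p : ℝ → Vec nr) (z z' : Vec nx × ℝ) : Prop where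
  mem_Icc : z.2 ∈ Icc (0 : ℝ) 1
  feasible : z ∈ P.GamTilde p
  governor : IsGreatest (P.candidates p (finalState ζ p z)) z'.2
  state : z'.1 = P.f (z.1, controlLaw ζ p z)

/-- The maximum in the governor's update law is attained, wherever the law is applied to the
optimal final predicted state of a feasible `(x, s)`. -/
def GovernorMaxAttained (P : MPCData nx nu nr N) (ζ : Vec nx × Vec nr → Plan nx nu N)
    (p : ℝ → Vec nr) : Prop :=
  ∀ z ∈ P.GamTilde p, z.2 ∈ Icc (0 : ℝ) 1 →
    ∃ s, IsGreatest (P.candidates p (finalState ζ p z)) s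

end MPCData

/-! ### Auxiliary facts on metric spaces and comparison functions -/

theorem UniformContinuousOn.isBounded_image_of_proper {α β : Type*} [PseudoMetricSpace α]
    [ProperSpace α] [PseudoMetricSpace β] {f : α → β} {s : Set α} (hf : UniformContinuousOn f s)
    (hs : Bornology.IsBounded s) : Bornology.IsBounded (f '' s) := by
  have h1 : TotallyBounded (univ : Set s) := by
    rw [← totallyBounded_image_iff (isUniformInducing_val s)]
    simpa using (hs.isCompact_closure.totallyBounded.subset subset_closure)
  have h2 := (h1.image (uniformContinuousOn_iff_restrict.1 hf)).isBounded
  simpa [image_univ, range_domRestrict] using h2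

theorem UniformContinuousOn.add_real {α : Type*} [PseudoMetricSpace α] {f g : α → ℝ} {s : Set α}
    (hf : UniformContinuousOn f s) (hg : UniformContinuousOn g s) :
    UniformContinuousOn (fun x => f x + g x) s := by
  rw [uniformContinuousOn_iff_restrict] at *
  exact hf.add hg

theorem UniformContinuousOn.sum_real {α ι : Type*} [PseudoMetricSpace α] {f : ι → α → ℝ}
    {s : Set α} (t : Finset ι) (hf : ∀ i ∈ t, UniformContinuousOn (f i) s) :
    UniformContinuousOn (fun x => ∑ i ∈ t, f i x) s := by
  classical
  induction t using Finset.induction_on with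
  | empty => simpa using uniformContinuous_const.uniformContinuousOn
  | insert a t ha ih =>
    simp only [Finset.sum_insert ha]
    exact (hf a (by simp)).add_real (ih fun i hi => hf i (by simp [hi]))

theorem UniformContinuousOn.prodMk_of {α β γ : Type*} [PseudoMetricSpace α] [PseudoMetricSpace β]
    [PseudoMetricSpace γ] {f : α → β} {g : α → γ} {s : Set α}
    (hf : UniformContinuousOn f s) (hg : UniformContinuousOn g s) :
    UniformContinuousOn (fun x => (f x, g x)) s := by
  rw [uniformContinuousOn_iff_restrict] at *
  exact hf.prodMk hg

/-- A monotone function on `[0, ∞)` that tends to zero at zero is dominated by a function of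
class `K`. -/
theorem Monotone.exists_isClassK_le {φ : ℝ → ℝ} (hφ : Monotone φ) (h0 : ∀ t, 0 ≤ φ t)
    (hlim : ∀ ε > 0, ∃ δ > 0, φ δ ≤ ε) : ∃ ς, IsClassK ς ∧ ∀ t, 0 ≤ t → φ t ≤ ς t := by
  have hint : ∀ a b, IntervalIntegrable φ MeasureTheory.volume a b :=
    fun a b => hφ.intervalIntegrable
  have hintc : ∀ c, 0 ≤ c → ∀ a b,
      IntervalIntegrable (fun v => φ (c * v)) MeasureTheory.volume a b := fun c hc a b =>
    Monotone.intervalIntegrable fun x y hxy => hφ (mul_le_mul_of_nonneg_left hxy hc)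
  -- Averaging over the dilations in `[1, 2]` removes jumps, and monotonicity keeps the average
  -- between `φ t` and `φ (2 * t)`.
  set ψ : ℝ → ℝ := fun t => ∫ v in (1 : ℝ)..2, φ (t * v) with hψ
  have hlow : ∀ t, 0 ≤ t → φ t ≤ ψ t := by
    intro t ht
    have := intervalIntegral.integral_mono_on (a := 1) (b := 2) (by norm_num)
      (intervalIntegrable_const (c := φ t)) (hintc t ht 1 2)
      (fun v hv => hφ (le_mul_of_one_le_right ht hv.1))
    simpa [show (2 : ℝ) - 1 = 1 by norm_num] using this
  have hup : ∀ t, 0 ≤ t → ψ t ≤ φ (2 * t) := by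
    intro t ht
    have := intervalIntegral.integral_mono_on (a := 1) (b := 2) (by norm_num)
      (hintc t ht 1 2) (intervalIntegrable_const (c := φ (2 * t)))
      (fun v hv => hφ (by nlinarith [hv.2]))
    simpa [show (2 : ℝ) - 1 = 1 by norm_num] using this
  have hφ0 : φ 0 = 0 := by
    refine le_antisymm (le_of_forall_pos_le_add fun ε hε => ?_) (h0 0)
    obtain ⟨δ, hδ, h⟩ := hlim ε hε
    linarith [hφ hδ.le]
  have hψ0 : ψ 0 = 0 := by simp [hψ, hφ0]
  have hmono : ∀ a b, 0 ≤ a → a ≤ b → ψ a ≤ ψ b := fun a b ha hab =>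
    intervalIntegral.integral_mono_on (by norm_num) (hintc a ha 1 2) (hintc b (ha.trans hab) 1 2)
      (fun v hv => hφ (mul_le_mul_of_nonneg_right hab (by linarith [hv.1])))
  have hcont : ContinuousOn ψ (Ici 0) := by
    intro t ht
    rcases (mem_Ici.1 ht).eq_or_lt with rfl | ht
    · rw [ContinuousWithinAt, hψ0, Metric.tendsto_nhdsWithin_nhds]
      intro ε hε
      obtain ⟨δ, hδ, h⟩ := hlim (ε / 2) (by positivity)
      refine ⟨δ / 2, by positivity, fun x hx hxd => ?_⟩
      have hx' : (0 : ℝ) ≤ x := hx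
      rw [Real.dist_eq, sub_zero, abs_of_nonneg hx'] at hxd
      rw [Real.dist_eq, sub_zero, abs_of_nonneg ((h0 x).trans (hlow x hx'))]
      have := (hup x hx').trans (hφ (show 2 * x ≤ δ by linarith))
      linarith
    · have hF : Continuous fun x => ∫ v in (0 : ℝ)..x, φ v :=
        intervalIntegral.continuous_primitive hint 0
      -- Away from zero, substitution gives `ψ x = x⁻¹ * ∫ v in x..2x, φ v`, a difference of
      -- continuous primitives.
      have h1 : ContinuousAt (fun x : ℝ => x⁻¹ *
          ((∫ v in (0 : ℝ)..(x * 2), φ v) - ∫ v in (0 : ℝ)..(x * 1), φ v)) t := by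
        have h2 : Continuous fun x : ℝ => ∫ v in (0 : ℝ)..(x * 2), φ v :=
          hF.comp (continuous_id.mul continuous_const)
        have h3 : Continuous fun x : ℝ => ∫ v in (0 : ℝ)..(x * 1), φ v :=
          hF.comp (continuous_id.mul continuous_const)
        exact (continuousAt_inv₀ ht.ne').mul (h2.sub h3).continuousAt
      refine (h1.congr ?_).continuousWithinAt
      filter_upwards [lt_mem_nhds ht] with x hx
      rw [intervalIntegral.integral_interval_sub_left (hint _ _) (hint _ _), hψ]
      simp only
      rw [intervalIntegral.integral_comp_mul_left _ hx.ne', smul_eq_mul]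
  -- The summand `t` makes the monotone `ψ` strictly increasing.
  refine ⟨fun t => ψ t + t, ⟨hcont.add continuousOn_id, ?_, by simp [hψ0]⟩, fun t ht => ?_⟩
  · intro a ha b _ hab
    have := hmono a b ha hab.le
    simp only
    linarith
  · have := hlow t ht
    simp only
    linarith

/-- A family of values `b i` that is small where `a i` is small and bounded where `a i` is bounded
is bounded by a class-`K` function of `a i`. -/
theorem exists_isClassK_bound {ι : Type*} (a b : ι → ℝ) (ha : ∀ i, 0 ≤ a i)
    (hloc : ∀ ε > 0, ∃ δ > 0, ∀ i, a i ≤ δ → b i ≤ ε)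
    (hbdd : ∀ M, ∃ C, ∀ i, a i ≤ M → b i ≤ C) :
    ∃ ς, IsClassK ς ∧ ∀ i, b i ≤ ς (a i) := by
  -- Inserting `0` keeps the set nonempty and its supremum nonnegative.
  set S : ℝ → Set ℝ := fun t => insert 0 (b '' {i | a i ≤ t}) with hS
  have hSb : ∀ t, BddAbove (S t) := fun t => by
    obtain ⟨C, hC⟩ := hbdd t
    refine BddAbove.insert 0 ⟨C, ?_⟩
    rintro _ ⟨i, hi, rfl⟩
    exact hC i hi
  obtain ⟨ς, h1, h2⟩ := Monotone.exists_isClassK_le (φ := fun t => sSup (S t))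
    (fun s t hst => csSup_le_csSup (hSb t) ⟨0, by simp [hS]⟩
      (insert_subset_insert (image_mono fun i (hi : a i ≤ s) => hi.trans hst)))
    (fun t => le_csSup (hSb t) (by simp [hS]))
    (fun ε hε => by
      obtain ⟨δ, hδ, h⟩ := hloc ε hε
      refine ⟨δ, hδ, csSup_le ⟨0, by simp [hS]⟩ ?_⟩
      rintro _ (rfl | ⟨i, hi, rfl⟩)
      exacts [hε.le, h i hi])
  exact ⟨ς, h1, fun i => le_trans (le_csSup (hSb (a i)) (Or.inr ⟨i, le_refl (a i), rfl⟩)) (h2 _ (ha i))⟩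

theorem IsClassK.pos {γ : ℝ → ℝ} (h : IsClassK γ) {t : ℝ} (ht : 0 < t) : 0 < γ t := by
  simpa [h.zero] using h.strictMonoOn (mem_Ici.2 le_rfl) (mem_Ici.2 ht.le) ht

theorem IsClassK.nonneg {γ : ℝ → ℝ} (h : IsClassK γ) {t : ℝ} (ht : 0 ≤ t) : 0 ≤ γ t := by
  simpa [h.zero] using h.strictMonoOn.monotoneOn (mem_Ici.2 le_rfl) (mem_Ici.2 ht) ht

theorem IsClassK.lt_of_lt {γ : ℝ → ℝ} (h : IsClassK γ) {s t : ℝ} (hs : 0 ≤ s) (ht : 0 ≤ t)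
    (hst : γ s < γ t) : s < t :=
  (h.strictMonoOn.lt_iff_lt (mem_Ici.2 hs) (mem_Ici.2 ht)).1 hst

namespace MPCData

section OptimalControl

variable {nx nu nr n : ℕ} {P : MPCData nx nu nr (n + 1)}
  {ζ : Vec nx × Vec nr → Plan nx nu (n + 1)}

/-! ### Recursive feasibility and decrease of the optimal cost -/

/-- The plan without its first step, continued by one step with the control `u`. -/
def shiftPlan (P : MPCData nx nu nr (n + 1)) (η : Plan nx nu (n + 1)) (u : Vec nu) :
    Plan nx nu (n + 1) :=
  (Fin.snoc (α := fun _ => Vec nx) (Fin.tail η.1) (P.f (η.1 (Fin.last _), u)),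
    Fin.snoc (α := fun _ => Vec nu) (Fin.tail η.2) u)

theorem shiftPlan_state_castSucc (η : Plan nx nu (n + 1)) (u : Vec nu) (i : Fin (n + 1)) :
    (P.shiftPlan η u).1 i.castSucc = η.1 i.succ := by
  simp [shiftPlan, Fin.snoc_castSucc, Fin.tail]

theorem shiftPlan_state_last (η : Plan nx nu (n + 1)) (u : Vec nu) :
    (P.shiftPlan η u).1 (Fin.last _) = P.f (η.1 (Fin.last _), u) := by
  simp [shiftPlan, Fin.snoc_last]

theorem shiftPlan_control_castSucc (η : Plan nx nu (n + 1)) (u : Vec nu) (i : Fin n) :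
    (P.shiftPlan η u).2 i.castSucc = η.2 i.succ := by
  simp [shiftPlan, Fin.snoc_castSucc, Fin.tail]

theorem shiftPlan_control_last (η : Plan nx nu (n + 1)) (u : Vec nu) :
    (P.shiftPlan η u).2 (Fin.last _) = u := by
  simp [shiftPlan, Fin.snoc_last]

/-- The reference enters the constraints only through the terminal one, so it may change to `r'`
during the shift. -/
theorem IsFeasible.shift {x : Vec nx} {r r' : Vec nr} {η : Plan nx nu (n + 1)} {u : Vec nu}
    (h : P.IsFeasible x r η) (hX : η.1 (Fin.last _) ∈ P.X) (hu : u ∈ P.U)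
    (hT : (P.f (η.1 (Fin.last _), u), r') ∈ P.T) :
    P.IsFeasible (η.1 1) r' (P.shiftPlan η u) where
  init := shiftPlan_state_castSucc η u 0
  dyn i := by
    induction i using Fin.lastCases with
    | last =>
      rw [Fin.succ_last, shiftPlan_state_last, shiftPlan_state_castSucc, shiftPlan_control_last,
        Fin.succ_last]
    | cast j =>
      rw [Fin.succ_castSucc, shiftPlan_state_castSucc, shiftPlan_state_castSucc,
        shiftPlan_control_castSucc, h.dyn j.succ, Fin.succ_castSucc]
  state_mem i := by
    rw [shiftPlan_state_castSucc]
    induction i using Fin.lastCases with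
    | last => rwa [Fin.succ_last]
    | cast j => rw [Fin.succ_castSucc]; exact h.state_mem _
  control_mem i := by
    induction i using Fin.lastCases with
    | last => rwa [shiftPlan_control_last]
    | cast j => rw [shiftPlan_control_castSucc]; exact h.control_mem _
  terminal := by rwa [shiftPlan_state_last]

theorem IsFeasible.state_mem_X (hmpc : P.MPCAssumption ζ) {x : Vec nx} {r : Vec nr}
    {η : Plan nx nu (n + 1)} (h : P.IsFeasible x r η) (i : Fin (n + 2)) : η.1 i ∈ P.X := by
  induction i using Fin.lastCases with
  | last => exact (hmpc.T_subset h.terminal).1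
  | cast j => exact h.state_mem j

/-- The cost of a plan for the reference `r'` instead of the one it was made for, without the
first stage. -/
def tailCost (P : MPCData nx nu nr (n + 1)) (η : Plan nx nu (n + 1)) (r' : Vec nr) : ℝ :=
  P.term (η.1 (Fin.last _), r') + ∑ i : Fin n, P.stage (η.1 i.succ.castSucc, η.2 i.succ, r')

theorem cost_eq_stage_add_tailCost (η : Plan nx nu (n + 1)) (r : Vec nr) :
    P.cost r η = P.stage (η.1 0, η.2 0, r) + P.tailCost η r := by
  rw [cost, tailCost, Fin.sum_univ_succ]
  simp only [Fin.castSucc_zero]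
  ring

/-- The bracket is nonpositive when `u` comes from the terminal law. -/
theorem cost_shiftPlan (η : Plan nx nu (n + 1)) (u : Vec nu) (r' : Vec nr) :
    P.cost r' (P.shiftPlan η u) = P.tailCost η r' + (P.stage (η.1 (Fin.last _), u, r') +
      P.term (P.f (η.1 (Fin.last _), u), r') - P.term (η.1 (Fin.last _), r')) := by
  rw [cost, tailCost, Fin.sum_univ_castSucc, shiftPlan_state_last]
  simp only [shiftPlan_state_castSucc, shiftPlan_control_castSucc, shiftPlan_control_last,
    Fin.succ_last, Fin.succ_castSucc]
  ring

/-- The optimal cost at `(x, r)`. -/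
def value (P : MPCData nx nu nr (n + 1)) (ζ : Vec nx × Vec nr → Plan nx nu (n + 1))
    (q : Vec nx × Vec nr) : ℝ := P.cost q.2 (ζ q)

/-- The next state and any reference for which the last predicted state is terminal are feasible,
with at most the cost of the remaining plan. -/
theorem next_mem_Gam_and_value_le (hζ : P.IsSolutionMap ζ) (hmpc : P.MPCAssumption ζ)
    {q : Vec nx × Vec nr} (hq : q ∈ P.Gam) {r' : Vec nr} (hr' : r' ∈ P.Reps)
    (hT : ((ζ q).1 (Fin.last _), r') ∈ P.T) :
    ((ζ q).1 1, r') ∈ P.Gam ∧ P.value ζ ((ζ q).1 1, r') ≤ P.tailCost (ζ q) r' := by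
  obtain ⟨κ, hκ⟩ := hmpc.terminal_law
  obtain ⟨h1, h2, h3, h4⟩ := hκ _ _ hT
  have hf := (hζ q hq).1
  have hsh := hf.shift h3 h4 h2
  have hG : ((ζ q).1 1, r') ∈ P.Gam := ⟨hf.state_mem_X hmpc 1, hr', _, hsh⟩
  refine ⟨hG, ((hζ _ hG).2 _ hsh).trans ?_⟩
  rw [cost_shiftPlan]
  linarith [h1 hr']

/-- Iterating the terminal law over the horizon never leaves the terminal set and so yields a
feasible plan. -/
theorem mem_Gam_of_mem_T (hmpc : P.MPCAssumption ζ) {x : Vec nx} {r : Vec nr}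
    (hT : (x, r) ∈ P.T) (hr : r ∈ P.Reps) : (x, r) ∈ P.Gam := by
  obtain ⟨κ, hκ⟩ := hmpc.terminal_law
  set F : Vec nx → Vec nx := fun y => P.f (y, κ (y, r)) with hF
  have hmem : ∀ k : ℕ, (F^[k] x, r) ∈ P.T := by
    intro k
    induction k with
    | zero => exact hT
    | succ k ih => rw [Function.iterate_succ_apply']; exact (hκ _ _ ih).2.1
  refine ⟨(hmpc.T_subset hT).1, hr, (fun i => F^[i] x, fun i => κ (F^[i] x, r)), ?_⟩
  exact ⟨rfl, fun i => Function.iterate_succ_apply' F i x, fun i => (hmpc.T_subset (hmem i)).1,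
    fun i => (hκ _ _ (hmem i)).2.2.2, hmem _⟩

theorem stage_le_value (hζ : P.IsSolutionMap ζ) (hmpc : P.MPCAssumption ζ)
    {q : Vec nx × Vec nr} (hq : q ∈ P.Gam) :
    P.stage (q.1, (ζ q).2 0, q.2) + P.term ((ζ q).1 (Fin.last _), q.2) ≤ P.value ζ q := by
  have hf := (hζ q hq).1
  have h : 0 ≤ ∑ i : Fin n, P.stage ((ζ q).1 i.succ.castSucc, (ζ q).2 i.succ, q.2) :=
    Finset.sum_nonneg fun i _ =>
      hmpc.stage_nonneg _ (hf.state_mem _) _ (hf.control_mem _) _ hq.2.1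
  rw [value, cost_eq_stage_add_tailCost, tailCost, hf.init]
  linarith

/-! ### Lower bound on the optimal cost, and optimal plans at equilibria -/

theorem classK_le_value (hζ : P.IsSolutionMap ζ) (hmpc : P.MPCAssumption ζ) {γ : ℝ → ℝ}
    (hγ : ∀ q ∈ P.Gam, ∀ u ∈ P.U, γ ‖q.1 - P.xbar q.2‖ ≤ P.stage (q.1, u, q.2))
    {q : Vec nx × Vec nr} (hq : q ∈ P.Gam) : γ ‖q.1 - P.xbar q.2‖ ≤ P.value ζ q := by
  have hf := (hζ q hq).1
  linarith [hγ q hq _ (hf.control_mem 0), stage_le_value hζ hmpc hq,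
    hmpc.term_nonneg _ hf.terminal]

theorem equil_mem_Gam (hmpc : P.MPCAssumption ζ) {r : Vec nr} (hr : r ∈ P.Reps) :
    (P.xbar r, r) ∈ P.Gam :=
  mem_Gam_of_mem_T hmpc (interior_subset (hmpc.equil_interior r hr)) hr

theorem value_equil_le (hζ : P.IsSolutionMap ζ) (hsys : P.SystemAssumption)
    (hmpc : P.MPCAssumption ζ) {r : Vec nr} (hr : r ∈ P.Reps) : P.value ζ (P.xbar r, r) ≤ 0 := by
  have hf : P.IsFeasible (P.xbar r) r (fun _ => P.xbar r, fun _ => P.ubar r) :=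
    ⟨rfl, fun _ => (hsys.steady r hr.1).symm, fun _ => hsys.xbar_mem r hr.1,
      fun _ => hsys.ubar_mem r hr.1, interior_subset (hmpc.equil_interior r hr)⟩
  refine ((hζ _ (equil_mem_Gam hmpc hr)).2 _ hf).trans ?_
  simp [cost, hmpc.term_equil r hr, hmpc.stage_equil r hr]

theorem eq_xbar_of_classK_le {γ : ℝ → ℝ} (hγ : IsClassK γ) {x y : Vec nx}
    (h : γ ‖x - y‖ ≤ 0) : x = y := by
  by_contra hne
  exact absurd (hγ.pos (norm_pos_iff.2 (sub_ne_zero.2 hne))) h.not_gt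

/-- The constant plan makes the optimal cost at most zero; hence so is the tail cost, which bounds
the cost at the next state. -/
theorem solution_equil_one (hζ : P.IsSolutionMap ζ) (hsys : P.SystemAssumption)
    (hmpc : P.MPCAssumption ζ) {r : Vec nr} (hr : r ∈ P.Reps) :
    (ζ (P.xbar r, r)).1 1 = P.xbar r := by
  obtain ⟨γ, hγK, hγ⟩ := hmpc.stage_lower
  have hq := equil_mem_Gam hmpc hr
  have hf := (hζ _ hq).1
  obtain ⟨h1, h2⟩ := next_mem_Gam_and_value_le hζ hmpc hq hr hf.terminal
  refine eq_xbar_of_classK_le hγK.toIsClassK ((classK_le_value hζ hmpc hγ h1).trans (h2.trans ?_))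
  have h3 := value_equil_le hζ hsys hmpc hr
  rw [value, cost_eq_stage_add_tailCost, hf.init] at h3
  have h4 := hmpc.stage_nonneg _ hq.1 _ (hf.control_mem 0) _ hr
  simp only at h3 h4
  linarith

/-- The terminal cost at the last state is at most zero, but it is not assumed positive definite.
One further step of the terminal law forces a zero stage cost there, and the stage cost does
identify the equilibrium. -/
theorem solution_equil_last (hζ : P.IsSolutionMap ζ) (hsys : P.SystemAssumption)
    (hmpc : P.MPCAssumption ζ) {r : Vec nr} (hr : r ∈ P.Reps) :
    (ζ (P.xbar r, r)).1 (Fin.last _) = P.xbar r := by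
  obtain ⟨γ, hγK, hγ⟩ := hmpc.stage_lower
  obtain ⟨κ, hκ⟩ := hmpc.terminal_law
  have hq := equil_mem_Gam hmpc hr
  have hf := (hζ _ hq).1
  obtain ⟨h1, h2, h3, h4⟩ := hκ _ _ hf.terminal
  refine eq_xbar_of_classK_le hγK.toIsClassK
    ((hγ _ (mem_Gam_of_mem_T hmpc hf.terminal hr) _ h4).trans ?_)
  have h5 := value_equil_le hζ hsys hmpc hr
  have h6 := stage_le_value hζ hmpc hq
  have h7 := hmpc.stage_nonneg _ hq.1 _ (hf.control_mem 0) _ hr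
  have h8 := hmpc.term_nonneg _ h2
  have h9 := h1 hr
  simp only at *
  linarith

/-! ### Uniform continuity of the optimal cost -/

theorem uniformContinuousOn_solution_state (hmpc : P.MPCAssumption ζ) (i : Fin (n + 2)) :
    UniformContinuousOn (fun q => (ζ q).1 i) P.Gam := by
  obtain ⟨L, hL⟩ := hmpc.solution_lipschitz
  exact ((Pi.uniformContinuous_proj _ i).comp uniformContinuous_fst).comp_uniformContinuousOn
    hL.uniformContinuousOn

theorem uniformContinuousOn_solution_control (hmpc : P.MPCAssumption ζ) (i : Fin (n + 1)) :
    UniformContinuousOn (fun q => (ζ q).2 i) P.Gam := by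
  obtain ⟨L, hL⟩ := hmpc.solution_lipschitz
  exact ((Pi.uniformContinuous_proj _ i).comp uniformContinuous_snd).comp_uniformContinuousOn
    hL.uniformContinuousOn

theorem uniformContinuousOn_value (hζ : P.IsSolutionMap ζ) (hmpc : P.MPCAssumption ζ) :
    UniformContinuousOn (P.value ζ) P.Gam := by
  have h2 : UniformContinuousOn (Prod.snd : Vec nx × Vec nr → Vec nr) P.Gam :=
    uniformContinuous_snd.uniformContinuousOn
  refine UniformContinuousOn.add_real
    (hmpc.term_unifCont.comp ((uniformContinuousOn_solution_state hmpc (Fin.last _)).prodMk_of h2)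
      fun q hq => (hζ q hq).1.terminal)
    (UniformContinuousOn.sum_real _ fun i _ => ?_)
  exact hmpc.stage_unifCont.comp ((uniformContinuousOn_solution_state hmpc i.castSucc).prodMk_of
    ((uniformContinuousOn_solution_control hmpc i).prodMk_of h2))
    fun q hq => ⟨(hζ q hq).1.state_mem i, (hζ q hq).1.control_mem i, hq.2.1⟩

/-- The optimal cost is small, uniformly in the reference, near the equilibrium. -/
theorem exists_value_lt_of_norm_lt (hζ : P.IsSolutionMap ζ) (hsys : P.SystemAssumption)
    (hmpc : P.MPCAssumption ζ) {ε : ℝ} (hε : 0 < ε) :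
    ∃ d > 0, ∀ q ∈ P.Gam, ‖q.1 - P.xbar q.2‖ < d → P.value ζ q < ε := by
  obtain ⟨d, hd, h⟩ := Metric.uniformContinuousOn_iff.1 (uniformContinuousOn_value hζ hmpc) ε hε
  refine ⟨d, hd, fun q hq hqd => ?_⟩
  -- The comparison point has the same reference, so only the state distance counts.
  have h1 := h q hq (P.xbar q.2, q.2) (equil_mem_Gam hmpc hq.2.1) (by
    rw [Prod.dist_eq]; simpa [dist_eq_norm, hd] using hqd)
  have h2 := value_equil_le hζ hsys hmpc hq.2.1
  rw [Real.dist_eq] at h1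
  linarith [(abs_lt.1 h1).2]

/-- A small change of the reference changes the cost of the remaining plan by little. -/
theorem exists_tailCost_le (hζ : P.IsSolutionMap ζ) (hmpc : P.MPCAssumption ζ)
    {ε : ℝ} (hε : 0 < ε) :
    ∃ d > 0, ∀ q ∈ P.Gam, ∀ r' ∈ P.Reps, ((ζ q).1 (Fin.last _), r') ∈ P.T → dist r' q.2 < d →
      P.tailCost (ζ q) r' ≤ P.tailCost (ζ q) q.2 + ε := by
  -- The tail cost has `n` stage terms and one terminal term.
  have hε' : 0 < ε / (n + 1) := by positivity
  obtain ⟨d₁, hd₁, h₁⟩ := Metric.uniformContinuousOn_iff.1 hmpc.term_unifCont _ hε'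
  obtain ⟨d₂, hd₂, h₂⟩ := Metric.uniformContinuousOn_iff.1 hmpc.stage_unifCont _ hε'
  refine ⟨min d₁ d₂, lt_min hd₁ hd₂, fun q hq r' hr' hT hd => ?_⟩
  have hf := (hζ q hq).1
  have hterm : P.term ((ζ q).1 (Fin.last _), r') ≤
      P.term ((ζ q).1 (Fin.last _), q.2) + ε / (n + 1) := by
    have := h₁ _ hT _ hf.terminal (by
      rw [Prod.dist_eq]; simpa [hd₁] using hd.trans_le (min_le_left _ _))
    rw [Real.dist_eq] at this
    linarith [(abs_lt.1 this).2]
  have hstage : ∀ i : Fin n, P.stage ((ζ q).1 i.succ.castSucc, (ζ q).2 i.succ, r') ≤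
      P.stage ((ζ q).1 i.succ.castSucc, (ζ q).2 i.succ, q.2) + ε / (n + 1) := by
    intro i
    have := h₂ ((ζ q).1 i.succ.castSucc, (ζ q).2 i.succ, r')
      ⟨hf.state_mem _, hf.control_mem _, hr'⟩ ((ζ q).1 i.succ.castSucc, (ζ q).2 i.succ, q.2)
      ⟨hf.state_mem _, hf.control_mem _, hq.2.1⟩ (by
        rw [Prod.dist_eq, Prod.dist_eq]; simpa [hd₂] using hd.trans_le (min_le_right _ _))
    rw [Real.dist_eq] at this
    linarith [(abs_lt.1 this).2]
  have hsum := Finset.sum_le_sum fun i (_ : i ∈ Finset.univ) => hstage i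
  rw [Finset.sum_add_distrib, Finset.sum_const, Finset.card_univ, Fintype.card_fin,
    nsmul_eq_mul] at hsum
  have he : ε / (n + 1) + n * (ε / (n + 1)) = ε := by field_simp; ring
  rw [tailCost, tailCost]
  linarith

/-- If the reference changes little, the optimal cost decreases by a fixed amount or ends up
small. -/
theorem exists_value_next_le (hζ : P.IsSolutionMap ζ) (hsys : P.SystemAssumption)
    (hmpc : P.MPCAssumption ζ) {ε : ℝ} (hε : 0 < ε) :
    ∃ d > 0, ∃ c > 0, ∀ q ∈ P.Gam, ∀ r' ∈ P.Reps, ((ζ q).1 (Fin.last _), r') ∈ P.T →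
      dist r' q.2 < d → P.value ζ ((ζ q).1 1, r') ≤ max (P.value ζ q - c) ε := by
  obtain ⟨γ, hγK, hγ⟩ := hmpc.stage_lower
  obtain ⟨e, he, hsmall⟩ := exists_value_lt_of_norm_lt hζ hsys hmpc (half_pos hε)
  have hγe : 0 < γ e := hγK.toIsClassK.pos he
  -- Within `e` of the equilibrium the cost is below `ε / 2` and rises by at most `ε / 2`; farther
  -- away the first stage saves `γ e`, of which the reference change consumes at most half.
  obtain ⟨d, hd, hdec⟩ := exists_tailCost_le hζ hmpc (lt_min (half_pos hε) (half_pos hγe))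
  refine ⟨d, hd, γ e / 2, half_pos hγe, fun q hq r' hr' hT hdist => ?_⟩
  have h1 := (next_mem_Gam_and_value_le hζ hmpc hq hr' hT).2
  have h2 := hdec q hq r' hr' hT hdist
  have hf := (hζ q hq).1
  have h3 : P.value ζ q = P.stage (q.1, (ζ q).2 0, q.2) + P.tailCost (ζ q) q.2 := by
    rw [value, cost_eq_stage_add_tailCost, hf.init]
  have h4 := hγ q hq _ (hf.control_mem 0)
  have h5 := hγK.toIsClassK.nonneg (norm_nonneg (q.1 - P.xbar q.2))
  have h6 := min_le_left (ε / 2) (γ e / 2)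
  have h7 := min_le_right (ε / 2) (γ e / 2)
  rcases lt_or_ge ‖q.1 - P.xbar q.2‖ e with h | h
  · exact le_max_of_le_right (by linarith [hsmall q hq h])
  · have h8 := hγK.strictMonoOn.monotoneOn (mem_Ici.2 he.le) (mem_Ici.2 (he.le.trans h)) h
    exact le_max_of_le_left (by linarith)

end OptimalControl

end MPCData

/-- The set need not be closed, so total boundedness replaces compactness. -/
theorem UniformContinuousOn.exists_norm_le {E F : Type*} [NormedAddCommGroup E] [ProperSpace E]
    [NormedAddCommGroup F] {f : E → F} {s : Set E} (hf : UniformContinuousOn f s) (R : ℝ) :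
    ∃ C, ∀ q ∈ s, ‖q‖ ≤ R → ‖f q‖ ≤ C := by
  have hb : Bornology.IsBounded (s ∩ Metric.closedBall 0 R) :=
    Metric.isBounded_closedBall.subset inter_subset_right
  obtain ⟨C, hC⟩ := ((hf.mono inter_subset_left).isBounded_image_of_proper hb).exists_norm_le
  exact ⟨C, fun q hq hqR => hC _ ⟨q, ⟨hq, by simpa using hqR⟩, rfl⟩⟩

namespace MPCData

section ClosedLoop

variable {nx nu nr n : ℕ} {P : MPCData nx nu nr (n + 1)}
  {ζ : Vec nx × Vec nr → Plan nx nu (n + 1)} {x₀ : Vec nx} {r : Vec nr} {p : ℝ → Vec nr}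

/-! ### Single steps of the closed loop -/

/-- The rest of the path from `z.2` on, reparametrised to `[0, 1]`, is a feasible path from `z.1`.
-/
theorem mem_Dx_of_mem_GamTilde (hp : P.IsFeasiblePath x₀ r p) {z : Vec nx × ℝ}
    (hz : z ∈ P.GamTilde p) (hs : z.2 ∈ Icc (0 : ℝ) 1) : z.1 ∈ P.Dx r := by
  have hmap : MapsTo (fun t : ℝ => z.2 + t * (1 - z.2)) (Icc 0 1) (Icc 0 1) := by
    rintro t ⟨ht0, ht1⟩
    have h1 : 0 ≤ 1 - z.2 := by linarith [hs.2]
    constructor <;> nlinarith [hs.1, mul_nonneg ht0 h1]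
  refine ⟨by rw [← hp.target]; exact hp.mem 1 (by simp),
    fun t => p (z.2 + t * (1 - z.2)), ?_, fun t ht => hp.mem _ (hmap ht), ?_, ?_⟩
  · exact hp.cont.comp (by fun_prop) hmap
  · simpa using (show (z.1, p z.2) ∈ P.Gam from hz)
  · simpa using hp.target

theorem attraction_set_eq (hp : P.IsFeasiblePath x₀ r p) {z : Vec nx × ℝ} :
    z ∈ (P.Dx r ×ˢ Icc (0 : ℝ) 1) ∩ P.GamTilde p ↔
      z.2 ∈ Icc (0 : ℝ) 1 ∧ z ∈ P.GamTilde p :=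
  ⟨fun h => ⟨h.1.2, h.2⟩, fun h => ⟨⟨mem_Dx_of_mem_GamTilde hp h.2 h.1, h.1⟩, h.2⟩⟩

variable {z z' : Vec nx × ℝ}

theorem ClosedLoop.state_eq (hζ : P.IsSolutionMap ζ) (h : P.ClosedLoop ζ p z z') :
    z'.1 = (ζ (z.1, p z.2)).1 1 := by
  have hf := (hζ _ h.feasible).1
  have := hf.dyn 0
  rw [Fin.castSucc_zero, hf.init] at this
  exact h.state.trans this.symm

/-- The terminal constraint of the current problem makes the current `s` a candidate. -/
theorem ClosedLoop.le (hζ : P.IsSolutionMap ζ) (h : P.ClosedLoop ζ p z z') : z.2 ≤ z'.2 :=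
  h.governor.2 ⟨h.mem_Icc, (hζ _ h.feasible).1.terminal⟩

theorem ClosedLoop.next_mem_GamTilde (hζ : P.IsSolutionMap ζ) (hmpc : P.MPCAssumption ζ)
    (hp : P.IsFeasiblePath x₀ r p) (h : P.ClosedLoop ζ p z z') : z' ∈ P.GamTilde p := by
  have := (next_mem_Gam_and_value_le hζ hmpc h.feasible (hp.mem _ h.governor.1.1)
    h.governor.1.2).1
  rwa [← h.state_eq hζ] at this

theorem ClosedLoop.exists_of_mem (hmax : P.GovernorMaxAttained ζ p)
    (hz : z ∈ P.GamTilde p) (hs : z.2 ∈ Icc (0 : ℝ) 1) : ∃ z', P.ClosedLoop ζ p z z' := by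
  obtain ⟨s, h⟩ := hmax z hz hs
  exact ⟨(P.f (z.1, controlLaw ζ p z), s), hs, hz, h, rfl⟩

theorem exists_closedLoop_value_le (hζ : P.IsSolutionMap ζ) (hsys : P.SystemAssumption)
    (hmpc : P.MPCAssumption ζ) (hp : P.IsFeasiblePath x₀ r p) {ε : ℝ} (hε : 0 < ε) :
    ∃ η > 0, ∃ c > 0, ∀ z z', P.ClosedLoop ζ p z z' → z'.2 - z.2 < η →
      P.value ζ (z'.1, p z'.2) ≤ max (P.value ζ (z.1, p z.2) - c) ε := by
  obtain ⟨d, hd, c, hc, h⟩ := exists_value_next_le hζ hsys hmpc hε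
  obtain ⟨η, hη, hpη⟩ := Metric.uniformContinuousOn_iff.1
    (isCompact_Icc.uniformContinuousOn_of_continuous hp.cont) d hd
  refine ⟨η, hη, c, hc, fun z z' hz hzη => ?_⟩
  rw [hz.state_eq hζ]
  refine h _ hz.feasible _ (hp.mem _ hz.governor.1.1) hz.governor.1.2
    (hpη _ hz.governor.1.1 _ hz.mem_Icc ?_)
  rwa [Real.dist_eq, abs_of_nonneg (sub_nonneg.2 (hz.le hζ))]

theorem continuousOn_xbar_path (hsys : P.SystemAssumption) (hp : P.IsFeasiblePath x₀ r p) :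
    ContinuousOn (fun s => P.xbar (p s)) (Icc 0 1) :=
  hsys.xbar_cont.comp hp.cont fun s hs => (hp.mem s hs).1

/-- Sublevel sets of the optimal cost are bounded. -/
theorem exists_norm_le_of_value_le (hζ : P.IsSolutionMap ζ) (hsys : P.SystemAssumption)
    (hmpc : P.MPCAssumption ζ) (hp : P.IsFeasiblePath x₀ r p) (C : ℝ) :
    ∃ B, ∀ z ∈ P.GamTilde p, z.2 ∈ Icc (0 : ℝ) 1 → P.value ζ (z.1, p z.2) ≤ C → ‖z.1‖ ≤ B := by
  obtain ⟨γ, hγK, hγ⟩ := hmpc.stage_lower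
  obtain ⟨D, hD, hD0⟩ := ((hγK.tendsto_atTop.eventually_gt_atTop C).and
    (eventually_ge_atTop 0)).exists
  obtain ⟨B, hB⟩ := isCompact_Icc.exists_bound_of_continuousOn (continuousOn_xbar_path hsys hp)
  refine ⟨B + D, fun z hz hs hzC => ?_⟩
  have h1 := classK_le_value hζ hmpc hγ hz
  have h2 := hγK.toIsClassK.lt_of_lt (norm_nonneg _) hD0 ((h1.trans hzC).trans_lt hD)
  have h3 := norm_le_norm_add_norm_sub (P.xbar (p z.2)) z.1
  rw [norm_sub_rev] at h3
  simp only at h2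
  linarith [hB _ hs]

theorem exists_value_le_of_norm_le (hζ : P.IsSolutionMap ζ) (hmpc : P.MPCAssumption ζ)
    (hp : P.IsFeasiblePath x₀ r p) (B : ℝ) :
    ∃ C, ∀ z ∈ P.GamTilde p, z.2 ∈ Icc (0 : ℝ) 1 → ‖z.1‖ ≤ B →
      P.value ζ (z.1, p z.2) ≤ C := by
  obtain ⟨B', hB'⟩ := isCompact_Icc.exists_bound_of_continuousOn hp.cont
  obtain ⟨C, hC⟩ := (uniformContinuousOn_value hζ hmpc).exists_norm_le (max B B')
  exact ⟨C, fun z hz hs hzB =>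
    (le_abs_self _).trans (hC _ hz (max_le_max hzB (hB' _ hs)))⟩

/-- This covers steps with a large increment of `s`, in which the cost may grow. -/
theorem exists_next_value_le (hζ : P.IsSolutionMap ζ) (hsys : P.SystemAssumption)
    (hmpc : P.MPCAssumption ζ) (hp : P.IsFeasiblePath x₀ r p) (C : ℝ) :
    ∃ C', ∀ z z', P.ClosedLoop ζ p z z' → P.value ζ (z.1, p z.2) ≤ C →
      P.value ζ (z'.1, p z'.2) ≤ C' := by
  obtain ⟨B, hB⟩ := exists_norm_le_of_value_le hζ hsys hmpc hp C
  obtain ⟨Bp, hBp⟩ := isCompact_Icc.exists_bound_of_continuousOn hp.cont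
  obtain ⟨B', hB'⟩ := (uniformContinuousOn_solution_state hmpc 1).exists_norm_le (max B Bp)
  obtain ⟨C', hC'⟩ := exists_value_le_of_norm_le hζ hmpc hp B'
  refine ⟨C', fun z z' h hz => hC' z' (h.next_mem_GamTilde hζ hmpc hp) h.governor.1.1 ?_⟩
  rw [h.state_eq hζ]
  exact hB' _ h.feasible (max_le_max (hB z h.feasible h.mem_Icc hz) (hBp _ h.mem_Icc))

/-! ### Solutions of the closed loop -/

variable {w : ℕ → Vec nx × ℝ}

theorem monotone_snd_of_isSolution (hζ : P.IsSolutionMap ζ)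
    (hw : IsSolution (P.ClosedLoop ζ p) w) : Monotone fun k => (w k).2 :=
  monotone_nat_of_le_succ fun k => (hw k).le hζ

theorem exists_isSolution (hζ : P.IsSolutionMap ζ) (hmpc : P.MPCAssumption ζ)
    (hp : P.IsFeasiblePath x₀ r p) (hmax : P.GovernorMaxAttained ζ p)
    (hz : z ∈ P.GamTilde p) (hs : z.2 ∈ Icc (0 : ℝ) 1) :
    ∃ w, IsSolution (P.ClosedLoop ζ p) w ∧ w 0 = z := by
  let A : Type := {z : Vec nx × ℝ // z ∈ P.GamTilde p ∧ z.2 ∈ Icc (0 : ℝ) 1}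
  have hstep : ∀ a : A, ∃ b : A, P.ClosedLoop ζ p a.1 b.1 := fun a => by
    obtain ⟨z', h⟩ := ClosedLoop.exists_of_mem hmax a.2.1 a.2.2
    exact ⟨⟨z', h.next_mem_GamTilde hζ hmpc hp, h.governor.1.1⟩, h⟩
  choose g hg using hstep
  refine ⟨fun k => (g^[k] ⟨z, hz, hs⟩).1, fun k => ?_, rfl⟩
  simp only [Function.iterate_succ_apply']
  exact hg _

theorem tendsto_of_isSolution (hζ : P.IsSolutionMap ζ) (hsys : P.SystemAssumption)
    (hmpc : P.MPCAssumption ζ) (hp : P.IsFeasiblePath x₀ r p)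
    (hw : IsSolution (P.ClosedLoop ζ p) w) : Tendsto w atTop (𝓝 (P.xbar r, 1)) := by
  obtain ⟨γ, hγK, hγ⟩ := hmpc.stage_lower
  have hI : ∀ k, (w k).2 ∈ Icc (0 : ℝ) 1 := fun k => (hw k).mem_Icc
  have hmono := monotone_snd_of_isSolution hζ hw
  have hbdd : BddAbove (range fun k => (w k).2) := ⟨1, by rintro _ ⟨k, rfl⟩; exact (hI k).2⟩
  obtain ⟨σ, hσ⟩ : ∃ σ, Tendsto (fun k => (w k).2) atTop (𝓝 σ) :=
    ⟨_, tendsto_atTop_ciSup hmono hbdd⟩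
  have hle : ∀ k, (w k).2 ≤ σ := hmono.ge_of_tendsto hσ
  have hσI : σ ∈ Icc (0 : ℝ) 1 := isClosed_Icc.mem_of_tendsto hσ (Eventually.of_forall hI)
  have hσ' : Tendsto (fun k => (w k).2) atTop (𝓝[Icc 0 1] σ) :=
    tendsto_nhdsWithin_iff.2 ⟨hσ, Eventually.of_forall hI⟩
  have hval : ∀ ε > 0, ∀ᶠ k in atTop, P.value ζ ((w k).1, p (w k).2) ≤ ε := by
    intro ε hε
    obtain ⟨η, hη, c, hc, h⟩ := exists_closedLoop_value_le hζ hsys hmpc hp hε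
    -- From time `K` on, all `s` lie in `(σ - η, σ]`, so every increment is below `η`.
    obtain ⟨K, hK⟩ := eventually_atTop.1 (hσ.eventually_const_lt (sub_lt_self σ hη))
    have hind : ∀ m : ℕ, P.value ζ ((w (K + m)).1, p (w (K + m)).2) ≤
        max (P.value ζ ((w K).1, p (w K).2) - m * c) ε := by
      intro m
      induction m with
      | zero => simp
      | succ m ih =>
        refine (h _ _ (hw (K + m)) ?_).trans (max_le ?_ (le_max_right _ _))
        · linarith [hK (K + m) (by omega), hle (K + m + 1)]
        · rw [sub_le_iff_le_add]
          refine ih.trans (max_le ?_ ?_)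
          · have := le_max_left (P.value ζ ((w K).1, p (w K).2) - (m + 1 : ℕ) * c) ε
            push_cast at this ⊢
            linarith
          · linarith [le_max_right (P.value ζ ((w K).1, p (w K).2) - (m + 1 : ℕ) * c) ε]
    obtain ⟨M, hM⟩ := exists_nat_ge (P.value ζ ((w K).1, p (w K).2) / c)
    refine eventually_atTop.2 ⟨K + M, fun k hk => ?_⟩
    obtain ⟨m, rfl⟩ := Nat.exists_eq_add_of_le hk
    rw [add_assoc]
    refine (hind (M + m)).trans (max_le ?_ le_rfl)
    rw [div_le_iff₀ hc] at hM
    push_cast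
    nlinarith [mul_nonneg (Nat.cast_nonneg (α := ℝ) m) hc.le]
  have hxbar : Tendsto (fun k => P.xbar (p (w k).2)) atTop (𝓝 (P.xbar (p σ))) :=
    (continuousOn_xbar_path hsys hp σ hσI).tendsto.comp hσ'
  have hdiff : Tendsto (fun k => (w k).1 - P.xbar (p (w k).2)) atTop (𝓝 0) := by
    rw [Metric.tendsto_nhds]
    intro ε hε
    filter_upwards [hval (γ ε / 2) (half_pos (hγK.toIsClassK.pos hε))] with k hk
    rw [dist_zero_right]
    refine hγK.toIsClassK.lt_of_lt (norm_nonneg _) hε.le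
      (((classK_le_value hζ hmpc hγ (hw k).feasible).trans hk).trans_lt ?_)
    linarith [hγK.toIsClassK.pos hε]
  have hx : Tendsto (fun k => (w k).1) atTop (𝓝 (P.xbar (p σ))) := by
    simpa using hdiff.add hxbar
  have hσ1 : σ = 1 := by
    by_contra hne
    have hlt : σ < 1 := lt_of_le_of_ne hσI.2 hne
    have hr := hp.mem σ hσI
    have hq : Tendsto (fun k => ((w k).1, p (w k).2)) atTop (𝓝[P.Gam] (P.xbar (p σ), p σ)) :=
      tendsto_nhdsWithin_iff.2 ⟨hx.prodMk_nhds ((hp.cont σ hσI).tendsto.comp hσ'),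
        Eventually.of_forall fun k => (hw k).feasible⟩
    have hlast : Tendsto (fun k => finalState ζ p (w k)) atTop (𝓝 (P.xbar (p σ))) := by
      have h := Tendsto.comp ((uniformContinuousOn_solution_state hmpc (Fin.last _)).continuousOn
        _ (equil_mem_Gam hmpc hr)) hq
      simp only [solution_equil_last hζ hsys hmpc hr] at h
      exact h
    obtain ⟨ρ, hρ, hball⟩ := Metric.mem_nhds_iff.1
      (mem_interior_iff_mem_nhds.1 (hmpc.equil_interior _ hr))
    obtain ⟨δ, hδ, hpδ⟩ := Metric.continuousOn_iff.1 hp.cont σ hσI ρ hρ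
    obtain ⟨k, hk⟩ := (Metric.tendsto_nhds.1 hlast ρ hρ).exists
    -- This parameter lies beyond `σ`, yet its reference is within `ρ` of `p σ`; it is therefore a
    -- candidate, contradicting that `σ` bounds all `s`.
    have hs1 : σ < min 1 (σ + δ / 2) := lt_min hlt (by linarith)
    have hsI : min 1 (σ + δ / 2) ∈ Icc (0 : ℝ) 1 :=
      ⟨hσI.1.trans hs1.le, min_le_left _ _⟩
    have hpd := hpδ _ hsI (by
      rw [Real.dist_eq, abs_of_pos (sub_pos.2 hs1)]
      linarith [min_le_right 1 (σ + δ / 2)])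
    have := (hw k).governor.2 ⟨hsI, hball (max_lt hk hpd)⟩
    exact absurd (this.trans (hle (k + 1))) hs1.not_ge
  rw [hσ1, hp.target] at hx
  rw [hσ1] at hσ
  exact hx.prodMk_nhds hσ

theorem isEquilibrium_closedLoop (hζ : P.IsSolutionMap ζ) (hsys : P.SystemAssumption)
    (hmpc : P.MPCAssumption ζ) (hp : P.IsFeasiblePath x₀ r p) :
    IsEquilibrium (P.ClosedLoop ζ p) (P.xbar r, 1) := by
  obtain rfl := hp.target
  have h1 : (1 : ℝ) ∈ Icc (0 : ℝ) 1 := by simp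
  have hr := hp.mem 1 h1
  have hG := equil_mem_Gam hmpc hr
  have hgreat : IsGreatest (P.candidates p (finalState ζ p (P.xbar (p 1), 1))) 1 := by
    refine ⟨⟨h1, ?_⟩, fun s hs => hs.1.2⟩
    rw [finalState, solution_equil_last hζ hsys hmpc hr]
    exact interior_subset (s := P.T) (hmpc.equil_interior _ hr)
  have hnext := solution_equil_one hζ hsys hmpc hr
  constructor
  · refine ⟨h1, hG, hgreat, ?_⟩
    have hf := (hζ _ hG).1
    have := hf.dyn 0
    rw [Fin.castSucc_zero, hf.init] at this
    exact hnext.symm.trans this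
  · intro z' h
    exact Prod.ext ((h.state_eq hζ).trans hnext) (h.governor.unique hgreat)

/-! ### Uniform bounds along solutions and Lyapunov stability -/

/-- Since `s` grows by at most `1` in total, induction on `m` bounds the cost as long as `s` has
grown by less than `m * η`. In the maximum, `C'` serves after a large step, `C₀` at the start, and
`1` is the floor for small steps. -/
theorem exists_value_le_of_dist_le (hζ : P.IsSolutionMap ζ) (hsys : P.SystemAssumption)
    (hmpc : P.MPCAssumption ζ) (hp : P.IsFeasiblePath x₀ r p) (M : ℝ) :
    ∃ C, ∀ w, IsSolution (P.ClosedLoop ζ p) w → dist (w 0) (P.xbar r, 1) ≤ M →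
      ∀ k, P.value ζ ((w k).1, p (w k).2) ≤ C := by
  obtain ⟨η, hη, c, hc, hsmall⟩ := exists_closedLoop_value_le hζ hsys hmpc hp one_pos
  obtain ⟨C₀, hC₀⟩ := exists_value_le_of_norm_le hζ hmpc hp (‖P.xbar r‖ + M)
  have hind : ∀ m : ℕ, ∃ C, ∀ w, IsSolution (P.ClosedLoop ζ p) w →
      dist (w 0) (P.xbar r, 1) ≤ M → ∀ k, (w k).2 - (w 0).2 < m * η →
      P.value ζ ((w k).1, p (w k).2) ≤ C := by
    intro m
    induction m with
    | zero =>
      refine ⟨0, fun w hw _ k hk => absurd hk ?_⟩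
      simpa using monotone_snd_of_isSolution hζ hw (Nat.zero_le k)
    | succ m ih =>
      obtain ⟨C, hC⟩ := ih
      obtain ⟨C', hC'⟩ := exists_next_value_le hζ hsys hmpc hp C
      refine ⟨max C' (max C₀ 1), fun w hw hwM k => ?_⟩
      induction k with
      | zero =>
        intro _
        refine (hC₀ _ (hw 0).feasible (hw 0).mem_Icc ?_).trans
          ((le_max_left _ _).trans (le_max_right _ _))
        have h1 : dist (w 0).1 (P.xbar r) ≤ M := (le_max_left _ _).trans hwM
        rw [dist_eq_norm] at h1
        have h2 := norm_le_norm_add_norm_sub (P.xbar r) (w 0).1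
        rw [norm_sub_rev] at h2
        linarith
      | succ k ihk =>
        intro hk
        have hmon := (hw k).le hζ
        push_cast at hk ihk
        rcases lt_or_ge ((w (k + 1)).2 - (w k).2) η with h | h
        · refine (hsmall _ _ (hw k) h).trans (max_le ?_
            ((le_max_right _ _).trans (le_max_right _ _)))
          linarith [ihk (by linarith)]
        -- A step of at least `η` ending below `(m + 1) * η` starts below `m * η`, where the
        -- previous bound applies.
        · exact (hC' _ _ (hw k) (hC w hw hwM k (by linarith))).trans (le_max_left _ _)
  obtain ⟨m, hm⟩ := exists_nat_gt (1 / η)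
  obtain ⟨C, hC⟩ := hind m
  refine ⟨C, fun w hw hwM k => hC w hw hwM k ?_⟩
  rw [div_lt_iff₀ hη] at hm
  linarith [(hw k).mem_Icc.2, (hw 0).mem_Icc.1]

theorem exists_dist_le_of_dist_le (hζ : P.IsSolutionMap ζ) (hsys : P.SystemAssumption)
    (hmpc : P.MPCAssumption ζ) (hp : P.IsFeasiblePath x₀ r p) (M : ℝ) :
    ∃ C, ∀ w, IsSolution (P.ClosedLoop ζ p) w → dist (w 0) (P.xbar r, 1) ≤ M →
      ∀ k, dist (w k) (P.xbar r, 1) ≤ C := by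
  obtain ⟨C, hC⟩ := exists_value_le_of_dist_le hζ hsys hmpc hp M
  obtain ⟨B, hB⟩ := exists_norm_le_of_value_le hζ hsys hmpc hp C
  refine ⟨max (B + ‖P.xbar r‖) 1, fun w hw hwM k => max_le_max ?_ ?_⟩
  · exact (dist_le_norm_add_norm _ _).trans
      (by linarith [hB _ (hw k).feasible (hw k).mem_Icc (hC w hw hwM k)])
  · have := (hw k).mem_Icc
    rw [Real.dist_eq, abs_le]
    constructor <;> simp only <;> linarith [this.1, this.2]

/-- With less than `η` left to `s = 1` no step is large, so the sublevel `γ (ε / 2) / 2` of the cost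
is invariant. It keeps `x` within `ε / 2` of the moving equilibrium, which itself is within `ε / 2`
of the final one. -/
theorem exists_dist_le_of_dist_small (hζ : P.IsSolutionMap ζ) (hsys : P.SystemAssumption)
    (hmpc : P.MPCAssumption ζ) (hp : P.IsFeasiblePath x₀ r p) {ε : ℝ} (hε : 0 < ε) :
    ∃ δ > 0, ∀ w, IsSolution (P.ClosedLoop ζ p) w → dist (w 0) (P.xbar r, 1) ≤ δ →
      ∀ k, dist (w k) (P.xbar r, 1) ≤ ε := by
  obtain rfl := hp.target
  have h1I : (1 : ℝ) ∈ Icc (0 : ℝ) 1 := by simp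
  obtain ⟨γ, hγK, hγ⟩ := hmpc.stage_lower
  have hγε := hγK.toIsClassK.pos (half_pos hε)
  obtain ⟨η, hη, c, hc, hsmall⟩ := exists_closedLoop_value_le hζ hsys hmpc hp (half_pos hγε)
  obtain ⟨d, hd, hval⟩ := exists_value_lt_of_norm_lt hζ hsys hmpc (half_pos hγε)
  obtain ⟨δ₁, hδ₁, h₁⟩ := Metric.continuousOn_iff.1 (continuousOn_xbar_path hsys hp) 1 h1I
    (min (ε / 2) (d / 2)) (lt_min (half_pos hε) (half_pos hd))
  have hmin : 0 < min (min η δ₁) (min (d / 2) ε) :=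
    lt_min (lt_min hη hδ₁) (lt_min (half_pos hd) hε)
  -- Here `η` keeps the steps small, `δ₁` limits the drift of the equilibrium, `d / 2` makes the
  -- initial cost small, and `ε` bounds the error in `s`. Halving gives strict inequalities.
  refine ⟨min (min η δ₁) (min (d / 2) ε) / 2, half_pos hmin, fun w hw hwδ => ?_⟩
  set δ := min (min η δ₁) (min (d / 2) ε) with hδ
  have hδη : δ ≤ η := (min_le_left _ _).trans (min_le_left _ _)
  have hδδ : δ ≤ δ₁ := (min_le_left _ _).trans (min_le_right _ _)
  have hδd : δ ≤ d / 2 := (min_le_right _ _).trans (min_le_left _ _)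
  have hδε : δ ≤ ε := (min_le_right _ _).trans (min_le_right _ _)
  have hx0 : dist (w 0).1 (P.xbar (p 1)) ≤ δ / 2 := (le_max_left _ _).trans hwδ
  have hs0 : dist (w 0).2 1 ≤ δ / 2 := (le_max_right _ _).trans hwδ
  rw [Real.dist_eq, abs_le] at hs0
  have hsk : ∀ k, 1 - (w k).2 < δ := fun k => by
    linarith [monotone_snd_of_isSolution hζ hw (Nat.zero_le k), hs0.1]
  have hbar : ∀ k, dist (P.xbar (p (w k).2)) (P.xbar (p 1)) < min (ε / 2) (d / 2) := fun k =>
    h₁ _ (hw k).mem_Icc (by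
      rw [dist_comm, Real.dist_eq, abs_of_nonneg (sub_nonneg.2 (hw k).mem_Icc.2)]
      exact (hsk k).trans_le hδδ)
  have hJ : ∀ k, P.value ζ ((w k).1, p (w k).2) ≤ γ (ε / 2) / 2 := by
    intro k
    induction k with
    | zero =>
      refine (hval _ (hw 0).feasible ?_).le
      have := dist_triangle_right (w 0).1 (P.xbar (p (w 0).2)) (P.xbar (p 1))
      rw [dist_eq_norm (w 0).1 (P.xbar (p (w 0).2))] at this
      linarith [hbar 0, min_le_right (ε / 2) (d / 2)]
    | succ k ih =>
      refine (hsmall _ _ (hw k) ?_).trans (max_le (by linarith) le_rfl)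
      linarith [hsk k, (hw (k + 1)).mem_Icc.2]
  intro k
  refine max_le ?_ ?_
  · have h2 := hγK.toIsClassK.lt_of_lt (norm_nonneg _) (half_pos hε).le
      (((classK_le_value hζ hmpc hγ (hw k).feasible).trans (hJ k)).trans_lt (half_lt_self hγε))
    rw [← dist_eq_norm] at h2
    have h3 := dist_triangle (w k).1 (P.xbar (p (w k).2)) (P.xbar (p 1))
    have h4 := hbar k
    have h5 := min_le_left (ε / 2) (d / 2)
    simp only at h2 h3 ⊢
    linarith
  · rw [dist_comm, Real.dist_eq, abs_of_nonneg (sub_nonneg.2 (hw k).mem_Icc.2)]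
    exact ((hsk k).trans_le hδε).le

theorem isLyapunovStableOn_closedLoop (hζ : P.IsSolutionMap ζ) (hsys : P.SystemAssumption)
    (hmpc : P.MPCAssumption ζ) (hp : P.IsFeasiblePath x₀ r p) (A : Set (Vec nx × ℝ)) :
    IsLyapunovStableOn (P.ClosedLoop ζ p) (P.xbar r, 1) A := by
  -- Indexing by pairs of a solution and a time gives one `ς` for all solutions and all times.
  obtain ⟨ς, hς, h⟩ := exists_isClassK_bound
    (ι := {w : ℕ → Vec nx × ℝ // IsSolution (P.ClosedLoop ζ p) w} × ℕ)
    (fun i => dist (i.1.1 0) (P.xbar r, 1)) (fun i => dist (i.1.1 i.2) (P.xbar r, 1))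
    (fun _ => dist_nonneg)
    (fun ε hε => by
      obtain ⟨δ, hδ, h⟩ := exists_dist_le_of_dist_small hζ hsys hmpc hp hε
      exact ⟨δ, hδ, fun i hi => h i.1.1 i.1.2 hi i.2⟩)
    (fun M => by
      obtain ⟨C, h⟩ := exists_dist_le_of_dist_le hζ hsys hmpc hp M
      exact ⟨C, fun i hi => h i.1.1 i.1.2 hi i.2⟩)
  exact ⟨ς, hς, fun w hw _ k => h (⟨w, hw⟩, k)⟩

/-- Near the equilibrium `(x, p s)` stays in the terminal set, from which the terminal law gives
feasibility. -/
theorem GamTilde_mem_nhdsWithin (hmpc : P.MPCAssumption ζ) (hp : P.IsFeasiblePath x₀ r p) :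
    P.GamTilde p ∈ 𝓝[univ ×ˢ Icc (0 : ℝ) 1] ((P.xbar r, 1) : Vec nx × ℝ) := by
  obtain rfl := hp.target
  have h1I : (1 : ℝ) ∈ Icc (0 : ℝ) 1 := by simp
  have hcont : ContinuousWithinAt (fun z : Vec nx × ℝ => (z.1, p z.2)) (univ ×ˢ Icc (0 : ℝ) 1)
      (P.xbar (p 1), 1) :=
    continuousWithinAt_fst.prodMk
      (ContinuousWithinAt.comp (t := Icc (0 : ℝ) 1) (x := ((P.xbar (p 1), 1) : Vec nx × ℝ))
        (hp.cont 1 h1I) continuousWithinAt_snd fun z hz => hz.2)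
  filter_upwards [hcont.preimage_mem_nhdsWithin
      (mem_interior_iff_mem_nhds.1 (hmpc.equil_interior _ (hp.mem 1 h1I))),
    self_mem_nhdsWithin] with z hz hzI
  exact mem_Gam_of_mem_T hmpc hz (hp.mem _ hzI.2)

end ClosedLoop

end MPCData

theorem theorem2 {nx nu nr N : ℕ} [NeZero N] (P : MPCData nx nu nr N)
    (ζ : Vec nx × Vec nr → MPCData.Plan nx nu N) (hζ : P.IsSolutionMap ζ)
    (planner : Vec nx × Vec nr → ℝ → Vec nr)
    (hsys : P.SystemAssumption) (hmpc : P.MPCAssumption ζ)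
    (hplan : P.PlannerAssumption planner)
    (r : Vec nr) (hr : r ∈ P.Reps) (x₀ : Vec nx) (hx₀ : x₀ ∈ P.Dx r)
    (hmax : P.GovernorMaxAttained ζ (planner (x₀, r))) :
    IsAsymptoticallyStableWithROA (P.ClosedLoop ζ (planner (x₀, r)))
      (Set.univ ×ˢ Set.Icc (0 : ℝ) 1) (P.xbar r, 1)
      ((P.Dx r ×ˢ Set.Icc (0 : ℝ) 1) ∩ P.GamTilde (planner (x₀, r))) := by
  obtain ⟨n, rfl⟩ := Nat.exists_eq_succ_of_ne_zero (NeZero.ne N)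
  have hp : P.IsFeasiblePath x₀ r (planner (x₀, r)) := hplan _ hx₀
  refine ⟨MPCData.isEquilibrium_closedLoop hζ hsys hmpc hp,
    MPCData.isLyapunovStableOn_closedLoop hζ hsys hmpc hp _, ?_, ?_⟩
  · ext z
    rw [MPCData.attraction_set_eq hp]
    constructor
    -- Definedness of the first step alone puts the initial state in the set; conversely, every
    -- solution converges.
    · rintro ⟨⟨w, hw, rfl⟩, -⟩
      exact ⟨(hw 0).mem_Icc, (hw 0).feasible⟩
    · rintro ⟨hI, hG⟩
      exact ⟨MPCData.exists_isSolution hζ hmpc hp hmax hG hI,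
        fun w hw _ => MPCData.tendsto_of_isSolution hζ hsys hmpc hp hw⟩
  · filter_upwards [MPCData.GamTilde_mem_nhdsWithin hmpc hp, self_mem_nhdsWithin] with z hz hzI
    exact (MPCData.attraction_set_eq hp).2 ⟨hzI.2, hz⟩
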